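/- Let $m\ge 0$ be an integer, $T>0$, and let $Q:\mathbb R\to \mathrm{Sym}(m,\mathbb R)$ be a continuous $T$-periodic path of symmetric $m\times m$ matrices. Consider the operator $\mathcal L=-\dfrac{d^2}{dt^2}+Q(t)$ and assume that: (i) $\mathcal L$ is reversible, i.e. $Q(-t)=Q(t)$ for all $t\in[0,T]$; (ii) $\mathcal L$ is non-degenerate, in the sense that there is no non-trivial symmetric $T$-periodic solution of $\mathcal L u=0$: if $u\in C^2(\mathbb R,\mathbb R^m)$ satisfies $\mathcal L u=0$, $u(t+T)=u(t)$ and $u(T-t)=u(t)$ for all $t$, then $u\equiv 0$; (iii) $\mathcal L$ has vanishing Morse index, i.e. the index form $$\mathcal I(u,w)=\int_0^T \langle \dot u,\dot w\rangle+\langle Q(t)u,w\rangle\,dt$$ on the real Sobolev space $E=\{u\in W^{1,2}([0,T];\mathbb R^m)\mid u(0)=u(T)\}$ has Morse index $0$, where the Morse index is the supremum of the dimensions of the linear subspaces of $E$ on which $\mathcal I$ is negative definite. Let $\gamma:[0,T]\to \mathrm{Mat}(2m,\mathbb R)$ be the fundamental solution of the associated linear Hamiltonian system, i.e. $\dot\gamma(t)=JB(t)\gamma(t)$,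 $\gamma(0)=I_{2m}$, where $J=\begin{bmatrix}0&-I_m\\ I_m&0\end{bmatrix}$ and $B(t)=\begin{bmatrix}I_m&0\\0&-Q(t)\end{bmatrix}$. Then the monodromy matrix $M_T=\gamma(T)$ is hyperbolic, i.e. no complex eigenvalue of $M_T$ lies on the unit circle. -/

import Mathlib

open MeasureTheory Matrix

namespace SecondOrder

/-- The Morse index of the form `B` on the real vector space `E`: the supremum of the dimensions of
the subspaces of `E` on which `B` is negative definite. -/
noncomputable def morseIndex {X : Type*} [AddCommGroup X] [Module ℝ X]
    (E : Submodule ℝ X) (B : X → X → ℝ) : ℕ∞ :=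
  ⨆ (V : Submodule ℝ X) (_ : V ≤ E) (_ : ∀ u ∈ V, u ≠ 0 → B u u < 0),
    Cardinal.toENat (Module.rank ℝ V)

/-- The real Sobolev space `{u ∈ W^{1,2}([0,T]; ℝ^m) | u(0) = u(T)}`. A `W^{1,2}` function is
represented by its absolutely continuous representative, that is, a function of the form
`u(t) = u(0) + ∫₀ᵗ v` with `v ∈ L²(0,T)`. So that elements are functions on `[0,T]` only, they
are given the value `0` outside of `[0,T]`. -/
def periodicSobolev (m : ℕ) (T : ℝ) : Submodule ℝ (ℝ → Fin m → ℝ) where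
  carrier := {u | (∃ v : ℝ → Fin m → ℝ, MemLp v 2 (volume.restrict (Set.Icc 0 T)) ∧
      ∀ t ∈ Set.Icc 0 T, u t = u 0 + ∫ s in (0 : ℝ)..t, v s) ∧
    u 0 = u T ∧ ∀ t ∉ Set.Icc 0 T, u t = 0}
  zero_mem' := ⟨⟨0, MemLp.zero, fun t _ => by simp⟩, rfl, fun t _ => rfl⟩
  smul_mem' := by
    rintro c u ⟨⟨v, hv, huv⟩, hb, h0⟩
    refine ⟨⟨c • v, hv.const_smul c, fun t ht => ?_⟩, by simp [hb], fun t ht => by simp [h0 t ht]⟩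
    simp [huv t ht, intervalIntegral.integral_smul]
  add_mem' := by
    rintro u u' ⟨⟨v, hv, huv⟩, hb, h0⟩ ⟨⟨v', hv', huv'⟩, hb', h0'⟩
    refine ⟨⟨v + v', hv.add hv', fun t ht => ?_⟩, by simp [hb, hb'],
      fun t ht => by simp [h0 t ht, h0' t ht]⟩
    have key : ∀ w : ℝ → Fin m → ℝ, MemLp w 2 (volume.restrict (Set.Icc 0 T)) →
        IntervalIntegrable w volume 0 t := fun w hw => by
      have h1 : IntegrableOn w (Set.Icc 0 T) := hw.integrable (by norm_num)
      rw [intervalIntegrable_iff_integrableOn_Icc_of_le ht.1]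
      exact h1.mono_set (Set.Icc_subset_Icc_right ht.2)
    simp only [Pi.add_apply]
    rw [intervalIntegral.integral_add (key v hv) (key v' hv'), huv t ht, huv' t ht]
    abel

/-- The index form `I(u,w) = ∫₀ᵀ ⟨u', w'⟩ + ⟨Q u, w⟩ dt` of `-d²/dt² + Q(t)`. On `W^{1,2}`
functions the classical derivative exists almost everywhere and is the weak derivative. -/
noncomputable def indexForm {m : ℕ} (Q : ℝ → Matrix (Fin m) (Fin m) ℝ) (T : ℝ)
    (u w : ℝ → Fin m → ℝ) : ℝ :=
  ∫ t in (0 : ℝ)..T, (deriv u t ⬝ᵥ deriv w t + (Q t *ᵥ u t) ⬝ᵥ w t)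

/-- `L = -d²/dt² + Q(t)` is reversible: `Q(-t) = Q(t)` on `[0,T]`. -/
def IsReversible {m : ℕ} (Q : ℝ → Matrix (Fin m) (Fin m) ℝ) (T : ℝ) : Prop :=
  ∀ t ∈ Set.Icc 0 T, Q (-t) = Q t

/-- The operator `L u = -u'' + Q u`. -/
noncomputable def schrodinger {m : ℕ} (Q : ℝ → Matrix (Fin m) (Fin m) ℝ)
    (u : ℝ → Fin m → ℝ) (t : ℝ) : Fin m → ℝ :=
  -deriv (deriv u) t + Q t *ᵥ u t

/-- `L` is non-degenerate: the only symmetric (that is, `u(T - t) = u(t)`) `T`-periodic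
solution of `L u = 0` is the trivial one. -/
def IsNonDegenerate {m : ℕ} (Q : ℝ → Matrix (Fin m) (Fin m) ℝ) (T : ℝ) : Prop :=
  ∀ u : ℝ → Fin m → ℝ, ContDiff ℝ 2 u → (∀ t, schrodinger Q u t = 0) →
    Function.Periodic u T → (∀ t, u (T - t) = u t) → u = 0

/-- The matrix `B(t) = diag(I, -Q(t))` of the Hamiltonian system `z' = J B(t) z`, `z = (u', u)`,
equivalent to `-u'' + Q u = 0`. -/
def hamiltonianMatrix {m : ℕ} (Q : ℝ → Matrix (Fin m) (Fin m) ℝ) (t : ℝ) :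
    Matrix (Fin m ⊕ Fin m) (Fin m ⊕ Fin m) ℝ :=
  Matrix.fromBlocks 1 0 0 (-Q t)

/-- `γ` is the fundamental solution on `[0,T]`: `γ' = J B(t) γ`, `γ(0) = I`,
where `J = [[0, -I], [I, 0]]`. -/
def IsFundamentalSolution {m : ℕ} (Q : ℝ → Matrix (Fin m) (Fin m) ℝ) (T : ℝ)
    (γ : ℝ → Matrix (Fin m ⊕ Fin m) (Fin m ⊕ Fin m) ℝ) : Prop :=
  γ 0 = 1 ∧ ∀ t ∈ Set.Icc 0 T, ∀ i j, HasDerivWithinAt (fun s => γ s i j)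
    ((Matrix.J (Fin m) ℝ * hamiltonianMatrix Q t * γ t) i j) (Set.Icc 0 T) t

/-- A real square matrix is hyperbolic if it has no complex eigenvalue on the unit circle. -/
def IsHyperbolic {ι : Type*} [Fintype ι] [DecidableEq ι] (M : Matrix ι ι ℝ) : Prop :=
  ∀ μ : ℂ, Module.End.HasEigenvalue (Matrix.toLin' (M.map Complex.ofReal)) μ → ‖μ‖ ≠ 1

end SecondOrder

/-!
# Hyperbolicity of reversible second order systems with vanishing Morse index

A reversible periodic `Q` satisfies `Q (T - t) = Q t`, so the interval `[0,T]` can be folded at its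
midpoint. Any `C¹` function on `[0,T/2]`, with no boundary condition at all, becomes a function in
the periodic Sobolev space when it is reflected about `T/2`, and the index form of the result is
twice the form on `[0,T/2]`. Vanishing of the Morse index therefore says that the form with free
(Neumann) boundary conditions on the half period is nonnegative (`integral_half_nonneg`).

If `μ` is an eigenvalue of the monodromy matrix with `‖μ‖ = 1`, an eigenvector gives a complex
solution `u` with `u T = μ u 0` and `u' T = μ u' 0`. Integrating by parts, its index form over
`[0,T]` is a boundary term, which is zero because `‖μ‖ = 1`. It is also the sum of four half-period
forms, those of the real and the imaginary part on `[0,T/2]` and, after reflection, on `[T/2,T]`.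
Hence all four vanish, and the real and the imaginary part minimise the Neumann form on `[0,T/2]`.
Being critical points, they satisfy the natural boundary conditions `u' 0 = u' (T/2) = 0`
(`IsSolution.deriv_eq_zero`). Their even `T`-periodic extensions are then `C²` symmetric periodic
solutions, which vanish by non-degeneracy (`IsSolution.apply_zero_eq_zero`). So `u 0 = u' 0 = 0`,
that is, the eigenvector is zero.
-/

namespace SecondOrder

/-! ### The index form and the half period -/

theorem morseIndex_ne_zero_of_neg {X : Type*} [AddCommGroup X] [Module ℝ X]
    {E : Submodule ℝ X} {B : X → X → ℝ} {v : X} (hv : v ∈ E)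
    (hB : ∀ c : ℝ, B (c • v) (c • v) = c ^ 2 * B v v) (hneg : B v v < 0) :
    morseIndex E B ≠ 0 := by
  have hv0 : v ≠ 0 := by
    rintro rfl
    have := hB 0
    simp only [smul_zero] at this
    nlinarith
  have hle : Cardinal.toENat (Module.rank ℝ (Submodule.span ℝ {v})) ≤ morseIndex E B := by
    refine le_iSup_of_le (Submodule.span ℝ {v}) (le_iSup_of_le ?_ (le_iSup_of_le ?_ le_rfl))
    · simpa [Submodule.span_le] using hv
    · intro u hu hu0
      obtain ⟨c, rfl⟩ := Submodule.mem_span_singleton.1 hu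
      have hc : c ≠ 0 := by rintro rfl; simp at hu0
      rw [hB]
      exact mul_neg_of_pos_of_neg (by positivity) hneg
  have h1 : Module.rank ℝ (Submodule.span ℝ {v}) = 1 := by
    rw [← Module.finrank_eq_rank, finrank_span_singleton hv0]; simp
  rw [h1] at hle
  intro h0
  rw [h0] at hle
  simp at hle

variable {m : ℕ} {T : ℝ} {Q : ℝ → Matrix (Fin m) (Fin m) ℝ}

theorem indexForm_smul_self (c : ℝ) (u : ℝ → Fin m → ℝ) :
    indexForm Q T (c • u) (c • u) = c ^ 2 * indexForm Q T u u := by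
  unfold indexForm
  rw [← intervalIntegral.integral_const_mul]
  congr 1
  funext t
  have : deriv (c • u) t = c • deriv u t := by
    exact deriv_const_smul_field c u
  simp only [this, Pi.smul_apply, Matrix.mulVec_smul, smul_dotProduct, dotProduct_smul, smul_eq_mul]
  ring

/-- The function on `[0,T]` that equals `φ` on `[0,T/2]` and is symmetric about `T/2`, with the
value `0` outside of `[0,T]`. -/
noncomputable def evenFold (T : ℝ) (φ : ℝ → Fin m → ℝ) (t : ℝ) : Fin m → ℝ :=
  if t ∈ Set.Icc 0 T then (if t ≤ T / 2 then φ t else φ (T - t)) else 0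

theorem evenFold_of_le {φ : ℝ → Fin m → ℝ} {t : ℝ} (h0 : 0 ≤ t) (h1 : t ≤ T / 2) :
    evenFold T φ t = φ t := by
  rw [evenFold, if_pos ⟨h0, by linarith⟩, if_pos h1]

theorem evenFold_of_ge {φ : ℝ → Fin m → ℝ} {t : ℝ} (h0 : T / 2 ≤ t) (h1 : t ≤ T) :
    evenFold T φ t = φ (T - t) := by
  rw [evenFold, if_pos ⟨by linarith, h1⟩]
  split_ifs with h
  · congr 1; linarith
  · rfl

theorem evenFold_mem_periodicSobolev (hT : 0 < T) {φ ψ : ℝ → Fin m → ℝ}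
    (hψ : Continuous ψ) (hφ : ∀ t, HasDerivAt φ (ψ t) t) :
    evenFold T φ ∈ periodicSobolev m T := by
  set D : ℝ → Fin m → ℝ := fun t => if t ≤ T / 2 then ψ t else -ψ (T - t) with hD
  have hr : Continuous fun t => -ψ (T - t) := by fun_prop
  have hleft : ∀ t, 0 ≤ t → t ≤ T / 2 → ∫ s in (0 : ℝ)..t, D s = φ t - φ 0 := by
    intro t h0 h1
    rw [← intervalIntegral.integral_eq_sub_of_hasDerivAt (fun s _ => hφ s)
      (hψ.intervalIntegrable _ _)]
    refine intervalIntegral.integral_congr fun s hs => ?_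
    rw [Set.uIcc_of_le h0] at hs
    simp [hD, hs.2.trans h1]
  refine ⟨⟨D, ?_, ?_⟩, ?_, fun t ht => if_neg ht⟩
  · obtain ⟨C, hC⟩ := isCompact_Icc.exists_bound_of_continuousOn (s := Set.Icc 0 T) hψ.continuousOn
    refine MemLp.of_bound (C := C) ?_ ?_
    · refine (Measurable.ite measurableSet_Iic hψ.measurable hr.measurable).aestronglyMeasurable
    · refine (ae_restrict_iff' measurableSet_Icc).2 (.of_forall fun t ht => ?_)
      simp only [hD]
      split_ifs
      · exact hC t ht
      · rw [norm_neg]; exact hC _ ⟨by linarith [ht.2], by linarith [ht.1]⟩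
  · rintro t ⟨h0, h1⟩
    rw [evenFold_of_le le_rfl (by linarith)]
    rcases le_total t (T / 2) with h | h
    · rw [evenFold_of_le h0 h, hleft t h0 h]; abel
    · have hright : ∫ s in (T / 2)..t, D s = φ (T - t) - φ (T / 2) := by
        rw [intervalIntegral.integral_congr_uIoo (g := fun s => -ψ (T - s)),
          intervalIntegral.integral_eq_sub_of_hasDerivAt (f := fun s => φ (T - s))
            (fun s _ => ?_) (hr.intervalIntegrable _ _)]
        · congr 2; ring
        · exact (hφ (T - s)).comp_const_sub T s
        · intro s hs
          rw [Set.uIoo_of_le h] at hs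
          simp [hD, not_le.2 hs.1]
      have i1 : IntervalIntegrable D volume 0 (T / 2) :=
        (intervalIntegrable_congr_uIoo (g := ψ) fun s hs => by
          rw [Set.uIoo_of_le (by linarith)] at hs
          simp [hD, hs.2.le]).2 (hψ.intervalIntegrable _ _)
      have i2 : IntervalIntegrable D volume (T / 2) t :=
        (intervalIntegrable_congr_uIoo (g := fun s => -ψ (T - s)) fun s hs => by
          rw [Set.uIoo_of_le h] at hs
          simp [hD, not_le.2 hs.1]).2 (hr.intervalIntegrable _ _)
      rw [evenFold_of_ge h h1, ← intervalIntegral.integral_add_adjacent_intervals i1 i2, hright,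
        hleft _ (by linarith) le_rfl]
      abel
  · rw [evenFold_of_le le_rfl (by linarith), evenFold_of_ge (by linarith) le_rfl, sub_self]

theorem indexForm_evenFold (hT : 0 < T) (hcont : Continuous Q) (hQ : ∀ t, Q (T - t) = Q t)
    {φ ψ : ℝ → Fin m → ℝ} (hψ : Continuous ψ) (hφ : ∀ t, HasDerivAt φ (ψ t) t) :
    indexForm Q T (evenFold T φ) (evenFold T φ) =
      2 * ∫ t in (0 : ℝ)..T / 2, (ψ t ⬝ᵥ ψ t + (Q t *ᵥ φ t) ⬝ᵥ φ t) := by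
  have hφc : Continuous φ := continuous_iff_continuousAt.2 fun t => (hφ t).continuousAt
  set F : ℝ → ℝ := fun t => ψ t ⬝ᵥ ψ t + (Q t *ᵥ φ t) ⬝ᵥ φ t with hF
  have hFc : Continuous F :=
    (hψ.dotProduct hψ).add ((hcont.matrix_mulVec hφc).dotProduct hφc)
  set G : ℝ → ℝ := fun t => deriv (evenFold T φ) t ⬝ᵥ deriv (evenFold T φ) t
    + (Q t *ᵥ evenFold T φ t) ⬝ᵥ evenFold T φ t with hG
  have e1 : Set.EqOn G F (Set.uIoo 0 (T / 2)) := by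
    intro t ht
    rw [Set.uIoo_of_le (by linarith)] at ht
    have hev : evenFold T φ =ᶠ[nhds t] φ := by
      filter_upwards [isOpen_Ioo.mem_nhds ht] with s hs using evenFold_of_le hs.1.le hs.2.le
    simp only [hG, hF]
    rw [hev.deriv_eq, hev.eq_of_nhds, (hφ t).deriv]
  have e2 : Set.EqOn G (fun t => F (T - t)) (Set.uIoo (T / 2) T) := by
    intro t ht
    rw [Set.uIoo_of_le (by linarith)] at ht
    have hev : evenFold T φ =ᶠ[nhds t] fun s => φ (T - s) := by
      filter_upwards [isOpen_Ioo.mem_nhds ht] with s hs using evenFold_of_ge hs.1.le hs.2.le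
    have hd : HasDerivAt (fun s => φ (T - s)) (-ψ (T - t)) t :=
      (hφ (T - t)).comp_const_sub T t
    simp only [hG, hF]
    rw [hev.deriv_eq, hev.eq_of_nhds, hd.deriv, hQ]
    simp
  have hFc' : Continuous fun t => F (T - t) := by fun_prop
  have i1 := (intervalIntegrable_congr_uIoo (μ := volume) e1).2 (hFc.intervalIntegrable _ _)
  have i2 := (intervalIntegrable_congr_uIoo (μ := volume) e2).2 (hFc'.intervalIntegrable _ _)
  change ∫ t in (0 : ℝ)..T, G t = _
  rw [← intervalIntegral.integral_add_adjacent_intervals i1 i2,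
    intervalIntegral.integral_congr_uIoo e1, intervalIntegral.integral_congr_uIoo e2,
    intervalIntegral.integral_comp_sub_left F T, sub_self, sub_half, two_mul]

/-- The form with free (Neumann) boundary conditions on the half period is nonnegative: the index
form of a function that is symmetric about `T/2` is twice its value on `[0,T/2]`, and such a
function automatically satisfies `u 0 = u T`, whatever its values at `0` and `T/2`. -/
theorem integral_half_nonneg (hT : 0 < T) (hcont : Continuous Q) (hQ : ∀ t, Q (T - t) = Q t)
    (hmorse : morseIndex (periodicSobolev m T) (indexForm Q T) = 0)
    {φ ψ : ℝ → Fin m → ℝ} (hψ : Continuous ψ) (hφ : ∀ t, HasDerivAt φ (ψ t) t) :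
    0 ≤ ∫ t in (0 : ℝ)..T / 2, (ψ t ⬝ᵥ ψ t + (Q t *ᵥ φ t) ⬝ᵥ φ t) := by
  by_contra! hneg
  refine morseIndex_ne_zero_of_neg (evenFold_mem_periodicSobolev hT hψ hφ)
    (fun c => indexForm_smul_self c _) ?_ hmorse
  rw [indexForm_evenFold hT hcont hQ hψ hφ]
  linarith

/-! ### Solutions and natural boundary conditions -/

/-- `q` solves `-q'' + Q q = 0` on the open interval `(0,T)` with derivative `p = q'`. Both functions
are defined on the whole line, with `q' = p` everywhere, so that `q` is an admissible variation
without boundary considerations; the equation itself is only required inside `(0,T)`. -/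
structure IsSolution (Q : ℝ → Matrix (Fin m) (Fin m) ℝ) (T : ℝ) (p q : ℝ → Fin m → ℝ) :
    Prop where
  continuous_deriv : Continuous p
  hasDerivAt : ∀ t, HasDerivAt q (p t) t
  hasDerivAt_deriv : ∀ t ∈ Set.Ioo 0 T, HasDerivAt p (Q t *ᵥ q t) t

namespace IsSolution

variable {p q : ℝ → Fin m → ℝ}

theorem continuous (h : IsSolution Q T p q) : Continuous q :=
  continuous_iff_continuousAt.2 fun t => (h.hasDerivAt t).continuousAt

theorem reflect (hQ : ∀ t, Q (T - t) = Q t) (h : IsSolution Q T p q) :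
    IsSolution Q T (fun t => -p (T - t)) (fun t => q (T - t)) where
  continuous_deriv := by have := h.continuous_deriv; fun_prop
  hasDerivAt t := (h.hasDerivAt (T - t)).comp_const_sub T t
  hasDerivAt_deriv t ht := by
    have := ((h.hasDerivAt_deriv (T - t) ⟨by linarith [ht.2], by linarith [ht.1]⟩).comp_const_sub
      T t).neg
    rw [hQ, neg_neg] at this
    exact this

/-- Integration by parts in the index form of a solution. -/
theorem integral_eq (hcont : Continuous Q) (h : IsSolution Q T p q) {φ ψ : ℝ → Fin m → ℝ}
    (hψ : Continuous ψ) (hφ : ∀ t, HasDerivAt φ (ψ t) t) {a b : ℝ} (ha : 0 ≤ a) (hab : a ≤ b)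
    (hb : b ≤ T) :
    ∫ t in a..b, (p t ⬝ᵥ ψ t + (Q t *ᵥ q t) ⬝ᵥ φ t) = p b ⬝ᵥ φ b - p a ⬝ᵥ φ a := by
  have hφc : Continuous φ := continuous_iff_continuousAt.2 fun t => (hφ t).continuousAt
  refine intervalIntegral.integral_eq_sub_of_hasDerivAt_of_le (f := fun t => p t ⬝ᵥ φ t) hab
    (h.continuous_deriv.dotProduct hφc).continuousOn (fun t ht => ?_)
    (((h.continuous_deriv.dotProduct hψ).add
      ((hcont.matrix_mulVec h.continuous).dotProduct hφc)).intervalIntegrable _ _)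
  have hp := hasDerivAt_pi.1 (h.hasDerivAt_deriv t ⟨ha.trans_lt ht.1, ht.2.trans_le hb⟩)
  have hφ' := hasDerivAt_pi.1 (hφ t)
  have := HasDerivAt.fun_sum (u := Finset.univ) fun i _ => (hp i).fun_mul (hφ' i)
  simp only [dotProduct]
  convert this using 1
  rw [Finset.sum_add_distrib, add_comm]

/-- A solution on which the nonnegative Neumann form of the half period vanishes is a critical
point of that form, hence satisfies the natural (Neumann) boundary conditions. -/
theorem deriv_eq_zero (hT : 0 < T) (hcont : Continuous Q) (hsymm : ∀ t, (Q t).IsSymm)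
    (hQ : ∀ t, Q (T - t) = Q t)
    (hmorse : morseIndex (periodicSobolev m T) (indexForm Q T) = 0) (h : IsSolution Q T p q)
    (h0 : ∫ t in (0 : ℝ)..T / 2, (p t ⬝ᵥ p t + (Q t *ᵥ q t) ⬝ᵥ q t) = 0) :
    p 0 = 0 ∧ p (T / 2) = 0 := by
  -- the affine variation with value `-p 0` at `0` and `p (T / 2)` at `T / 2`
  set d : Fin m → ℝ := (T / 2)⁻¹ • (p (T / 2) + p 0) with hd
  set φ : ℝ → Fin m → ℝ := fun t => -p 0 + t • d with hφdef
  have hφ : ∀ t, HasDerivAt φ d t := fun t => by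
    have := ((hasDerivAt_id t).smul_const d).const_add (-p 0)
    rwa [one_smul] at this
  have hφc : Continuous φ := by fun_prop
  have hφ0 : φ 0 = -p 0 := by simp [hφdef]
  have hφT : φ (T / 2) = p (T / 2) := by
    simp only [hφdef, hd]
    rw [smul_smul, mul_inv_cancel₀ (by positivity), one_smul]; abel
  have hp := h.continuous_deriv
  have hq := h.continuous
  have hfirst := h.integral_eq hcont continuous_const hφ le_rfl (by linarith : (0 : ℝ) ≤ T / 2)
    (by linarith)
  have c1 : Continuous fun t => p t ⬝ᵥ p t + (Q t *ᵥ q t) ⬝ᵥ q t :=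
    (hp.dotProduct hp).add ((hcont.matrix_mulVec hq).dotProduct hq)
  have c2 : Continuous fun t => p t ⬝ᵥ d + (Q t *ᵥ q t) ⬝ᵥ φ t :=
    (hp.dotProduct continuous_const).add ((hcont.matrix_mulVec hq).dotProduct hφc)
  have c3 : Continuous fun t => d ⬝ᵥ d + (Q t *ᵥ φ t) ⬝ᵥ φ t :=
    continuous_const.add ((hcont.matrix_mulVec hφc).dotProduct hφc)
  have hquad : ∀ s : ℝ, 0 ≤ 2 * s * (p (T / 2) ⬝ᵥ p (T / 2) + p 0 ⬝ᵥ p 0) +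
      s ^ 2 * ∫ t in (0 : ℝ)..T / 2, (d ⬝ᵥ d + (Q t *ᵥ φ t) ⬝ᵥ φ t) := by
    intro s
    have hn := integral_half_nonneg hT hcont hQ hmorse (φ := fun t => q t + s • φ t)
      (ψ := fun t => p t + s • d) (by fun_prop)
      (fun t => (h.hasDerivAt t).add ((hφ t).const_smul s))
    have hexp : ∀ t, (p t + s • d) ⬝ᵥ (p t + s • d) +
        (Q t *ᵥ (q t + s • φ t)) ⬝ᵥ (q t + s • φ t) =
        (p t ⬝ᵥ p t + (Q t *ᵥ q t) ⬝ᵥ q t) + (2 * s) * (p t ⬝ᵥ d + (Q t *ᵥ q t) ⬝ᵥ φ t) +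
          s ^ 2 * (d ⬝ᵥ d + (Q t *ᵥ φ t) ⬝ᵥ φ t) := by
      intro t
      have hs : (Q t *ᵥ φ t) ⬝ᵥ q t = (Q t *ᵥ q t) ⬝ᵥ φ t := by
        rw [dotProduct_comm, dotProduct_mulVec, ← mulVec_transpose, (hsymm t).eq]
      simp only [mulVec_add, mulVec_smul, add_dotProduct, dotProduct_add, smul_dotProduct,
        dotProduct_smul, smul_eq_mul, hs, dotProduct_comm d (p t)]
      ring
    simp only [hexp] at hn
    rw [intervalIntegral.integral_add, intervalIntegral.integral_add, h0,
      intervalIntegral.integral_const_mul, intervalIntegral.integral_const_mul, hfirst,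
      hφ0, hφT] at hn
    · simpa using hn
    · exact c1.intervalIntegrable _ _
    · exact (c2.const_mul _).intervalIntegrable _ _
    · exact (c1.add (c2.const_mul _)).intervalIntegrable _ _
    · exact (c3.const_mul _).intervalIntegrable _ _
  generalize (∫ t in (0 : ℝ)..T / 2, (d ⬝ᵥ d + (Q t *ᵥ φ t) ⬝ᵥ φ t)) = C at hquad
  have n1 : 0 ≤ p (T / 2) ⬝ᵥ p (T / 2) := Finset.sum_nonneg fun i _ => mul_self_nonneg _
  have n2 : 0 ≤ p 0 ⬝ᵥ p 0 := Finset.sum_nonneg fun i _ => mul_self_nonneg _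
  have hB : p (T / 2) ⬝ᵥ p (T / 2) + p 0 ⬝ᵥ p 0 = 0 := by
    generalize p (T / 2) ⬝ᵥ p (T / 2) + p 0 ⬝ᵥ p 0 = B at hquad
    -- the discriminant of the nonnegative quadratic `C s² + 2 B s` is nonpositive
    have := discrim_le_zero (a := C) (b := 2 * B) (c := 0) fun s => by linarith [hquad s]
    rw [discrim] at this
    nlinarith
  exact ⟨dotProduct_self_eq_zero.1 (by linarith), dotProduct_self_eq_zero.1 (by linarith)⟩

end IsSolution

/-! ### Even periodic extension -/

theorem integral_zero_neg_of_even {E : Type*} [NormedAddCommGroup E] [NormedSpace ℝ E]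
    {f : ℝ → E} (hf : Function.Even f) (t : ℝ) :
    ∫ s in (0 : ℝ)..-t, f s = -∫ s in (0 : ℝ)..t, f s := by
  have := intervalIntegral.integral_comp_neg (a := 0) (b := t) f
  simp only [hf _, neg_zero] at this
  rw [this, intervalIntegral.integral_symm]

theorem integral_zero_neg_of_odd {E : Type*} [NormedAddCommGroup E] [NormedSpace ℝ E]
    {f : ℝ → E} (hf : Function.Odd f) (t : ℝ) :
    ∫ s in (0 : ℝ)..-t, f s = ∫ s in (0 : ℝ)..t, f s := by
  have := intervalIntegral.integral_comp_neg (a := 0) (b := t) f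
  simp only [hf _, neg_zero, intervalIntegral.integral_neg] at this
  rw [intervalIntegral.integral_symm, ← this, neg_neg]

theorem periodic_integral_of_integral_eq_zero {E : Type*} [NormedAddCommGroup E]
    [NormedSpace ℝ E] {f : ℝ → E} (hc : Continuous f) (hf : Function.Periodic f T)
    (h0 : ∫ s in (0 : ℝ)..T, f s = 0) :
    Function.Periodic (fun t => ∫ s in (0 : ℝ)..t, f s) T := fun t => by
  have := hf.intervalIntegral_add_eq_add 0 t fun _ _ => hc.intervalIntegrable _ _
  simpa [h0] using this

/-- The distance of `t` to `Tℤ` is the representative in `[0,T/2]` of `t` under the group generated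
by `t ↦ -t` and `t ↦ t + T`. -/
theorem apply_norm_addCircle {E : Type*} {f : ℝ → E} (he : Function.Even f)
    (hf : Function.Periodic f T) (t : ℝ) : f ‖(t : AddCircle T)‖ = f t := by
  have habs : ∀ x, f |x| = f x := fun x => by
    rcases abs_choice x with h | h <;> rw [h]
    exact he x
  rw [AddCircle.norm_eq, habs]
  exact hf.sub_int_mul_eq _

/-- A solution with Neumann boundary conditions on the half period extends evenly and periodically
to a symmetric `T`-periodic solution on the line, so it vanishes at `0` if the operator is
non-degenerate. -/
theorem IsSolution.apply_zero_eq_zero {p q : ℝ → Fin m → ℝ} (hT : 0 < T) (hcont : Continuous Q)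
    (heven : Function.Even Q) (hper : Function.Periodic Q T) (hnondeg : IsNonDegenerate Q T)
    (h : IsSolution Q T p q) (hp0 : p 0 = 0) (hpT : p (T / 2) = 0) : q 0 = 0 := by
  have hr : ∀ t, 0 ≤ t → t ≤ T / 2 → ‖(t : AddCircle T)‖ = t := fun t h0 h1 => by
    rw [(AddCircle.norm_coe_eq_abs_iff T hT.ne').2] <;> simp [abs_of_nonneg, h0, hT.le, h1]
  set X : ℝ → Fin m → ℝ := fun t => q ‖(t : AddCircle T)‖ with hX
  have hXc : Continuous X := h.continuous.comp (continuous_norm.comp (AddCircle.continuous_mk' T))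
  have hXp : Function.Periodic X T := fun t => by simp [hX]
  have hXe : Function.Even X := fun t => by simp [hX]
  set F : ℝ → Fin m → ℝ := fun t => Q t *ᵥ X t with hF
  have hFc : Continuous F := hcont.matrix_mulVec hXc
  have hFp : Function.Periodic F T := fun t => by simp only [hF, hper t, hXp t]
  have hFe : Function.Even F := fun t => by simp only [hF, heven t, hXe t]
  -- Integrating `Q X` twice gives a `C²` function without any matching at the endpoints.
  set V : ℝ → Fin m → ℝ := fun t => ∫ s in (0 : ℝ)..t, F s with hV
  have hVd : ∀ t, HasDerivAt V (F t) t := fun t => (hFc.integral_hasStrictDerivAt 0 t).hasDerivAt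
  have hVc : Continuous V := continuous_iff_continuousAt.2 fun t => (hVd t).continuousAt
  have hVeq : ∀ t, 0 ≤ t → t ≤ T / 2 → V t = p t := by
    intro t h0 h1
    rw [← sub_zero (p t), ← hp0, ← intervalIntegral.integral_eq_sub_of_hasDerivAt_of_le h0
      h.continuous_deriv.continuousOn
      (fun s hs => h.hasDerivAt_deriv s ⟨hs.1, by linarith [hs.2]⟩)
      ((hcont.matrix_mulVec h.continuous).intervalIntegrable _ _)]
    refine intervalIntegral.integral_congr fun s hs => ?_
    rw [Set.uIcc_of_le h0] at hs
    simp only [hF, hX]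
    rw [hr s hs.1 (hs.2.trans h1)]
  have hVo : Function.Odd V := fun t => integral_zero_neg_of_even hFe t
  have hVT : V T = 0 := by
    have e : ∫ s in (T / 2)..T, F s = ∫ s in (0 : ℝ)..T / 2, F s := by
      have := intervalIntegral.integral_comp_sub_left (a := 0) (b := T / 2) F T
      rw [sub_zero, sub_half] at this
      rw [← this]
      congr 1; funext s
      rw [← hFe s, ← hFp (-s)]; congr 1; ring
    simp only [hV]
    rw [← intervalIntegral.integral_add_adjacent_intervals (b := T / 2)
      (hFc.intervalIntegrable _ _) (hFc.intervalIntegrable _ _), e]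
    have : ∫ s in (0 : ℝ)..T / 2, F s = 0 := (hVeq _ (by linarith) le_rfl).trans hpT
    rw [this, add_zero]
  have hVp : Function.Periodic V T := periodic_integral_of_integral_eq_zero hFc hFp hVT
  have hVi : ∫ s in (0 : ℝ)..T, V s = 0 := by
    have := intervalIntegral.integral_comp_sub_left (a := 0) (b := T) V T
    rw [sub_zero, sub_self] at this
    have e : ∀ s, V (T - s) = -V s := fun s => by
      rw [← hVo s, ← hVp (-s)]; congr 1; ring
    simp only [e, intervalIntegral.integral_neg] at this
    exact self_eq_neg.1 this.symm
  set U : ℝ → Fin m → ℝ := fun t => q 0 + ∫ s in (0 : ℝ)..t, V s with hU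
  have hUd : ∀ t, HasDerivAt U (V t) t := fun t =>
    (hVc.integral_hasStrictDerivAt 0 t).hasDerivAt.const_add _
  have hUe : Function.Even U := fun t => by simp only [hU, integral_zero_neg_of_odd hVo]
  have hUp : Function.Periodic U T := fun t => by
    simp only [hU]
    exact congrArg _ (periodic_integral_of_integral_eq_zero hVc hVp hVi t)
  have hUX : U = X := by
    funext t
    rw [← apply_norm_addCircle hUe hUp t]
    have hle : ‖(t : AddCircle T)‖ ≤ T / 2 := by
      simpa [abs_of_pos hT] using AddCircle.norm_le_half_period T (x := (t : AddCircle T)) hT.ne'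
    simp only [hU, hX]
    rw [intervalIntegral.integral_congr (g := p) fun s hs => ?_,
      intervalIntegral.integral_eq_sub_of_hasDerivAt (fun s _ => h.hasDerivAt s)
        (h.continuous_deriv.intervalIntegrable _ _), add_sub_cancel]
    rw [Set.uIcc_of_le (norm_nonneg _)] at hs
    exact hVeq s hs.1 (hs.2.trans hle)
  have dU : deriv U = V := funext fun t => (hUd t).deriv
  have dV : deriv V = F := funext fun t => (hVd t).deriv
  have hUC : ContDiff ℝ 2 U := by
    have : ContDiff ℝ 1 V :=
      contDiff_one_iff_deriv.2 ⟨fun t => (hVd t).differentiableAt, dV ▸ hFc⟩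
    rw [show (2 : WithTop ℕ∞) = 1 + 1 by norm_num, contDiff_succ_iff_deriv, dU]
    exact ⟨fun t => (hUd t).differentiableAt, by simp, this⟩
  have hzero := hnondeg U hUC (fun t => by rw [schrodinger, dU, dV, hUX]; simp [hF]) hUp
    (fun t => by rw [← hUe t, ← hUp (-t)]; congr 1; ring)
  simpa [hU] using congrFun hzero 0

/-! ### The monodromy matrix -/

theorem IsReversible.even (hT : 0 < T) (hper : Function.Periodic Q T) (hrev : IsReversible Q T) :
    Function.Even Q := fun t => by
  have hy := Int.fract_nonneg (t / T)
  have hy' := (Int.fract_lt_one (t / T)).le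
  have e : t = Int.fract (t / T) * T + ⌊t / T⌋ * T := by
    rw [← add_mul, Int.fract_add_floor, div_mul_cancel₀ _ hT.ne']
  have h := hrev (Int.fract (t / T) * T) ⟨by positivity, by nlinarith⟩
  generalize Int.fract (t / T) * T = y at e h
  rw [e, neg_add, ← sub_eq_add_neg, hper.sub_int_mul_eq, h, hper.int_mul]

/-- The orbits `t ↦ γ t *ᵥ a = (p t, q t)` of the Hamiltonian system are the pairs consisting of a
solution `q` and its derivative `p`. -/
theorem IsFundamentalSolution.exists_isSolution (hT : 0 < T)
    {γ : ℝ → Matrix (Fin m ⊕ Fin m) (Fin m ⊕ Fin m) ℝ} (hγ : IsFundamentalSolution Q T γ)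
    (a : Fin m ⊕ Fin m → ℝ) :
    ∃ p q, IsSolution Q T p q ∧ ∀ t ∈ Set.Icc 0 T, γ t *ᵥ a = Sum.elim (p t) (q t) := by
  set p₀ : ℝ → Fin m → ℝ := fun t i => (γ t *ᵥ a) (Sum.inl i) with hp₀
  set q₀ : ℝ → Fin m → ℝ := fun t i => (γ t *ᵥ a) (Sum.inr i) with hq₀
  have hsplit : ∀ t, γ t *ᵥ a = Sum.elim (p₀ t) (q₀ t) := fun t => by
    ext (i | i) <;> rfl
  have hz : ∀ t ∈ Set.Icc 0 T, ∀ k, HasDerivWithinAt (fun s => (γ s *ᵥ a) k)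
      (Sum.elim (Q t *ᵥ q₀ t) (p₀ t) k) (Set.Icc 0 T) t := by
    intro t ht k
    have h1 := HasDerivWithinAt.fun_sum (u := Finset.univ) fun j _ =>
      (hγ.2 t ht k j).mul_const (a j)
    have h2 : (Matrix.J (Fin m) ℝ * hamiltonianMatrix Q t * γ t) *ᵥ a =
        Sum.elim (Q t *ᵥ q₀ t) (p₀ t) := by
      rw [← mulVec_mulVec, hsplit, Matrix.J, hamiltonianMatrix, fromBlocks_multiply,
        fromBlocks_mulVec]
      simp
    rw [← h2]
    exact h1
  have hp₀d : ∀ t ∈ Set.Icc 0 T, HasDerivWithinAt p₀ (Q t *ᵥ q₀ t) (Set.Icc 0 T) t :=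
    fun t ht => hasDerivWithinAt_pi.2 fun i => hz t ht (Sum.inl i)
  have hq₀d : ∀ t ∈ Set.Icc 0 T, HasDerivWithinAt q₀ (p₀ t) (Set.Icc 0 T) t :=
    fun t ht => hasDerivWithinAt_pi.2 fun i => hz t ht (Sum.inr i)
  have hp₀c : ContinuousOn p₀ (Set.Icc 0 T) := fun t ht => (hp₀d t ht).continuousWithinAt
  have hq₀c : ContinuousOn q₀ (Set.Icc 0 T) := fun t ht => (hq₀d t ht).continuousWithinAt
  -- `p` continues `p₀` by constants, `q` is the primitive of `p` that continues `q₀`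
  set p : ℝ → Fin m → ℝ := Set.IccExtend hT.le ((Set.Icc 0 T).domRestrict p₀)
  set q : ℝ → Fin m → ℝ := fun t => q₀ 0 + ∫ s in (0 : ℝ)..t, p s with hq
  have hpc : Continuous p := hp₀c.domRestrict.Icc_extend'
  have hpp : ∀ t ∈ Set.Icc 0 T, p t = p₀ t := fun t ht => Set.IccExtend_of_mem hT.le _ ht
  have hqq : ∀ t ∈ Set.Icc 0 T, q t = q₀ t := by
    intro t ht
    have := intervalIntegral.integral_eq_sub_of_hasDerivAt_of_le (f := q₀) (f' := p) ht.1
      (hq₀c.mono (Set.Icc_subset_Icc_right ht.2)) (fun s hs => ?_) (hpc.intervalIntegrable _ _)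
    · simp only [hq, this, add_sub_cancel]
    · have hs' : s ∈ Set.Ioo 0 T := ⟨hs.1, hs.2.trans_le ht.2⟩
      rw [hpp s (Set.Ioo_subset_Icc_self hs')]
      exact (hq₀d s (Set.Ioo_subset_Icc_self hs')).hasDerivAt (Icc_mem_nhds hs'.1 hs'.2)
  refine ⟨p, q, ⟨hpc, fun t => (hpc.integral_hasStrictDerivAt 0 t).hasDerivAt.const_add _,
    fun t ht => ?_⟩, fun t ht => by rw [hsplit, hpp t ht, hqq t ht]⟩
  have ht' := Set.Ioo_subset_Icc_self ht
  rw [hqq t ht']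
  refine ((hp₀d t ht').hasDerivAt (Icc_mem_nhds ht.1 ht.2)).congr_of_eventuallyEq ?_
  filter_upwards [isOpen_Ioo.mem_nhds ht] with s hs using hpp s (Set.Ioo_subset_Icc_self hs)

/-- The index form of a solution over `[0,T]`, split at `T/2` into the half-period forms of the
solution and of its reflection, equals the boundary term of the integration by parts. -/
theorem IsSolution.integral_add_integral_reflect {p q : ℝ → Fin m → ℝ} (hT : 0 < T)
    (hcont : Continuous Q) (hQ : ∀ t, Q (T - t) = Q t) (h : IsSolution Q T p q) :
    (∫ t in (0 : ℝ)..T / 2, (p t ⬝ᵥ p t + (Q t *ᵥ q t) ⬝ᵥ q t)) +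
      ∫ t in (0 : ℝ)..T / 2, (-p (T - t) ⬝ᵥ -p (T - t) + (Q t *ᵥ q (T - t)) ⬝ᵥ q (T - t)) =
    p T ⬝ᵥ q T - p 0 ⬝ᵥ q 0 := by
  rw [h.integral_eq hcont h.continuous_deriv h.hasDerivAt le_rfl (by linarith) (by linarith),
    (h.reflect hQ).integral_eq hcont (h.reflect hQ).continuous_deriv (h.reflect hQ).hasDerivAt
      le_rfl (by linarith) (by linarith)]
  simp only [sub_half, sub_zero, neg_dotProduct]
  ring

end SecondOrder

theorem mainTheorem9 (m : ℕ) (T : ℝ) (hT : 0 < T)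
    (Q : ℝ → Matrix (Fin m) (Fin m) ℝ) (hcont : Continuous Q)
    (hsymm : ∀ t, (Q t).IsSymm) (hper : Function.Periodic Q T)
    (hrev : SecondOrder.IsReversible Q T)
    (hnondeg : SecondOrder.IsNonDegenerate Q T)
    (hmorse : SecondOrder.morseIndex (SecondOrder.periodicSobolev m T)
      (SecondOrder.indexForm Q T) = 0)
    (γ : ℝ → Matrix (Fin m ⊕ Fin m) (Fin m ⊕ Fin m) ℝ)
    (hγ : SecondOrder.IsFundamentalSolution Q T γ) :
    SecondOrder.IsHyperbolic (γ T) := by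
  intro μ hμ hnorm
  have heven := hrev.even hT hper
  have hQ : ∀ t, Q (T - t) = Q t := fun t => by
    rw [← heven t, ← hper (-t)]; congr 1; ring
  obtain ⟨ξ, hξ⟩ := hμ.exists_hasEigenvector
  have hξe := hξ.apply_eq_smul
  rw [toLin'_apply] at hξe
  set a : Fin m ⊕ Fin m → ℝ := fun k => (ξ k).re with ha
  set b : Fin m ⊕ Fin m → ℝ := fun k => (ξ k).im with hb
  have hTa : γ T *ᵥ a = μ.re • a - μ.im • b := by
    ext k
    simpa [mulVec, dotProduct, ha, hb] using congrArg Complex.re (congrFun hξe k)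
  have hTb : γ T *ᵥ b = μ.im • a + μ.re • b := by
    ext k
    have := congrArg Complex.im (congrFun hξe k)
    simp [mulVec, dotProduct, ha, hb] at this ⊢
    linarith
  obtain ⟨p, q, h, hpq⟩ := hγ.exists_isSolution hT a
  obtain ⟨r, s, k, hrs⟩ := hγ.exists_isSolution hT b
  have h0 : (0 : ℝ) ∈ Set.Icc 0 T := ⟨le_rfl, hT.le⟩
  have h1 : T ∈ Set.Icc 0 T := ⟨hT.le, le_rfl⟩
  have hpq0 := hpq 0 h0
  have hrs0 := hrs 0 h0
  rw [hγ.1, one_mulVec] at hpq0 hrs0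
  have hpqT := hpq T h1
  have hrsT := hrs T h1
  rw [hTa, hpq0, hrs0] at hpqT
  rw [hTb, hpq0, hrs0] at hrsT
  have hpT : p T = μ.re • p 0 - μ.im • r 0 :=
    funext fun i => by simpa using (congrFun hpqT (Sum.inl i)).symm
  have hqT : q T = μ.re • q 0 - μ.im • s 0 :=
    funext fun i => by simpa using (congrFun hpqT (Sum.inr i)).symm
  have hrT : r T = μ.im • p 0 + μ.re • r 0 :=
    funext fun i => by simpa using (congrFun hrsT (Sum.inl i)).symm
  have hsT : s T = μ.im • q 0 + μ.re • s 0 :=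
    funext fun i => by simpa using (congrFun hrsT (Sum.inr i)).symm
  have hμ2 : μ.re * μ.re + μ.im * μ.im = 1 := by
    rw [← Complex.normSq_apply, Complex.normSq_eq_norm_sq, hnorm, one_pow]
  -- since `‖μ‖ = 1`, the Hermitian product of `u'` and `u` has the same real part at `0` and `T`
  have hbdry : p T ⬝ᵥ q T + r T ⬝ᵥ s T = p 0 ⬝ᵥ q 0 + r 0 ⬝ᵥ s 0 := by
    rw [hpT, hqT, hrT, hsT]
    simp only [add_dotProduct, sub_dotProduct, dotProduct_add, dotProduct_sub, smul_dotProduct,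
      dotProduct_smul, smul_eq_mul]
    linear_combination (p 0 ⬝ᵥ q 0 + r 0 ⬝ᵥ s 0) * hμ2
  have e1 := h.integral_add_integral_reflect hT hcont hQ
  have e2 := k.integral_add_integral_reflect hT hcont hQ
  -- four nonnegative half-period forms with sum zero, so each of them vanishes
  have n1 := SecondOrder.integral_half_nonneg hT hcont hQ hmorse h.continuous_deriv h.hasDerivAt
  have n2 := SecondOrder.integral_half_nonneg hT hcont hQ hmorse (h.reflect hQ).continuous_deriv
    (h.reflect hQ).hasDerivAt
  have n3 := SecondOrder.integral_half_nonneg hT hcont hQ hmorse k.continuous_deriv k.hasDerivAt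
  have n4 := SecondOrder.integral_half_nonneg hT hcont hQ hmorse (k.reflect hQ).continuous_deriv
    (k.reflect hQ).hasDerivAt
  obtain ⟨hp0, hpT2⟩ := h.deriv_eq_zero hT hcont hsymm hQ hmorse (by linarith)
  obtain ⟨hr0, hrT2⟩ := k.deriv_eq_zero hT hcont hsymm hQ hmorse (by linarith)
  have hq0 := h.apply_zero_eq_zero hT hcont heven hper hnondeg hp0 hpT2
  have hs0 := k.apply_zero_eq_zero hT hcont heven hper hnondeg hr0 hrT2
  rw [hp0, hq0] at hpq0
  rw [hr0, hs0] at hrs0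
  refine hξ.2 (funext fun i => Complex.ext ?_ ?_)
  · simpa [ha] using! (congrFun hpq0 i).trans (by cases i <;> rfl : _ = (0 : ℝ))
  · simpa [hb] using! (congrFun hrs0 i).trans (by cases i <;> rfl : _ = (0 : ℝ))
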